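/- Let $d \ge 1$ be an integer. For $\lambda > 0$ and a probability measure $\nu$ on $]0,+\infty[$, let $\xi$ be a Poisson point process on $\mathbb{R}^d \times ]0,+\infty[$ whose intensity measure is the product of $\lambda|\cdot|$ and $\nu$, where $|\cdot|$ is Lebesgue measure; $P_{\lambda,\nu}$ and $E_{\lambda,\nu}$ denote the associated probability and expectation. Let $\Sigma = \bigcup_{(c,r) \in \xi} B(c,r)$, where $B(c,r)$ is the open Euclidean ball with centre $c$ and radius $r$. Let $S$ be the connected component of $\Sigma$ that contains the origin ($S = \emptyset$ if $0 \notin \Sigma$), and let $M = \sup_{x \in S} \|x\| \in [0,+\infty]$ ($M = 0$ if $S = \emptyset$). Percolation is the event that $S$ is unbounded. Let $R$ be a random variable with law $\nu$, so that $E(R^p) = \int r^p\,\nu(dr)$. There exists a positive constant $\tilde C$ that depends only on the dimension $d$, such that the following assertions hold for every probability measure $\nu$ on $]0,+\infty[$: 1. if $E(R^d)$ is finite, then $P_{\lambda,\nu}(\text{percolation}) = 0$ for all real $\lambda$ with $0 < \lambda < \tilde C\,(E(R^d))^{-1}$; 2. for all real $s > 0$, if $E(R^{d+s})$ is finite, then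 $M$ is a (measurable) random variable and $E_{\lambda,\nu}(M^s)$ is finite for all real $\lambda$ with $0 < \lambda < \tilde C\,(E(R^d))^{-1}$. -/

import Mathlib

open MeasureTheory ProbabilityTheory
open scoped NNReal ENNReal

universe u

noncomputable section

namespace BooleanModel

/-- The number of points (possibly infinite) of the random set `ξ` in the region `B`. -/
def pointCount {Ω X : Type*} (ξ : Ω → Set X) (B : Set X) (ω : Ω) : ℕ∞ :=
  (ξ ω ∩ B).encard

/-- `ξ` is, under `P`, a Poisson point process on `X` with intensity measure `μ`, realised as a
random set of points (the intensities used here have no atoms, so the process has no multiple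
points): the number of points in a measurable set `B` is a random variable, it is Poisson
distributed with mean `μ B` (almost surely infinite if `μ B = ∞`), and the numbers of points in
finitely many pairwise disjoint measurable sets are independent. -/
structure IsPoissonPointProcess {Ω X : Type*} [MeasurableSpace Ω] [MeasurableSpace X]
    (ξ : Ω → Set X) (μ : Measure X) (P : Measure Ω) : Prop where
  measurable_pointCount : ∀ B : Set X, MeasurableSet B → Measurable (pointCount ξ B)
  map_pointCount : ∀ B : Set X, MeasurableSet B → ∀ m : ℝ≥0, μ B = m →
    P.map (pointCount ξ B) = (poissonMeasure m).map (fun k : ℕ => (k : ℕ∞))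
  pointCount_eq_top : ∀ B : Set X, MeasurableSet B → μ B = ∞ →
    ∀ᵐ ω ∂P, pointCount ξ B ω = ⊤
  iIndepFun_pointCount : ∀ (n : ℕ) (B : Fin n → Set X), (∀ i, MeasurableSet (B i)) →
    Pairwise (fun i j => Disjoint (B i) (B j)) → iIndepFun (fun i => pointCount ξ (B i)) P

/-- The space `ℝ^d × ]0, +∞[` of pairs (centre, radius). -/
abbrev Marked (d : ℕ) : Type := EuclideanSpace ℝ (Fin d) × Set.Ioi (0 : ℝ)

/-- The intensity measure `λ |·| ⊗ ν` on `ℝ^d × ]0, +∞[`. -/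
def intensity (d : ℕ) (lam : ℝ≥0) (ν : Measure (Set.Ioi (0 : ℝ))) : Measure (Marked d) :=
  (lam • (volume : Measure (EuclideanSpace ℝ (Fin d)))).prod ν

/-- The moment `E(R^p) = ∫ r^p ν(dr)`, with values in `[0, +∞]`. -/
def moment (ν : Measure (Set.Ioi (0 : ℝ))) (p : ℝ) : ℝ≥0∞ :=
  ∫⁻ r, ENNReal.ofReal ((r : ℝ) ^ p) ∂ν

/-- `Σ`, the union of the open balls `B(c, r)` over the points `(c, r)` of a configuration. -/
def occupied {d : ℕ} (z : Set (Marked d)) : Set (EuclideanSpace ℝ (Fin d)) :=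
  ⋃ p ∈ z, Metric.ball p.1 (p.2 : ℝ)

/-- `S`, the connected component of `Σ` containing the origin (empty if `0 ∉ Σ`). -/
def cluster {d : ℕ} (z : Set (Marked d)) : Set (EuclideanSpace ℝ (Fin d)) :=
  connectedComponentIn (occupied z) 0

/-- Percolation: the component of the origin is unbounded. -/
def Percolates {d : ℕ} (z : Set (Marked d)) : Prop :=
  ¬ Bornology.IsBounded (cluster z)

/-- `M = sup_{x ∈ S} ‖x‖`, with values in `[0, +∞]` (it is `0` if `S` is empty). -/
def clusterRadius {d : ℕ} (z : Set (Marked d)) : ℝ≥0∞ :=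
  ⨆ x ∈ cluster z, ‖x‖ₑ

end BooleanModel

end

/-! The proof is multiscale. The cluster is made of chains of touching balls, so if it reaches far
at scale `α`, then either a ball of radius comparable to `α` or more lies close by relative to its
radius, or a chain of small balls crosses an annulus at scale `α` inside a bounded window. A
crossing at scale `10 * α` without large balls contains two crossings at scale `α` in disjoint
windows (`Crossing.exists_crossing`). These two are independent for a Poisson process, and they are
centred at points of a finite net whose size depends only on `d`.

The crossing probability, multiplied by the squared size of the net, therefore satisfies `v (n + 1)
≤ v n ^ 2 + h n`. The forcing `h n` is a constant times `λ` times the tail of `∫ r ^ d dν` at scale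
`10 ^ n * α` (`intensity_large`). Smallness of `λ E(R^d)` gives `h n ≤ 1 / 4`, and a small initial
scale gives `v 0 ≤ 1 / 2`, so `v` tends to `0` and percolation is a null event. If `E(R^(d+s))` is
finite, then `10 ^ (s * n) * h n` is summable. The recursion passes this on to `v`
(`summable_pow_mul_sqIter`), and summing over scales bounds `E(M^s)`. -/

namespace BooleanModel

/-! ### Chains in a random set and measurability of linking events. -/

/-- Some point of `z ∩ U` is joined to some point of `z ∩ V` by a chain of points of `z` whose
consecutive terms are related by `R`. -/
def Linked {X : Type*} (R : X → X → Prop) (z U V : Set X) : Prop :=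
  ∃ p ∈ U ∩ z, ∃ q ∈ V ∩ z, Relation.ReflTransGen (fun a b => a ∈ z ∧ b ∈ z ∧ R a b) p q

/-- The end points of the chains of length `n` in `z` that start in `U`. -/
def reachIn {X : Type*} (R : X → X → Prop) (z U : Set X) : ℕ → Set X
  | 0 => U ∩ z
  | n + 1 => {q | q ∈ z ∧ ∃ p ∈ reachIn R z U n, R p q}

theorem reachIn_subset {X : Type*} (R : X → X → Prop) (z U : Set X) (n : ℕ) :
    reachIn R z U n ⊆ z := by
  cases n with
  | zero => exact Set.inter_subset_right
  | succ n => exact fun q hq => hq.1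

/-- Sorting chains by length writes linking as a countable union whose terms can be handled by
induction. -/
theorem linked_iff_exists_reachIn {X : Type*} (R : X → X → Prop) (z U V : Set X) :
    Linked R z U V ↔ ∃ n, (reachIn R z U n ∩ V).Nonempty := by
  constructor
  · rintro ⟨p, hp, q, hq, h⟩
    have : ∃ n, q ∈ reachIn R z U n := by
      clear hq
      induction h with
      | refl => exact ⟨0, hp⟩
      | tail _ h ih =>
        obtain ⟨n, hn⟩ := ih
        exact ⟨n + 1, h.2.1, _, hn, h.2.2⟩
    obtain ⟨n, hn⟩ := this
    exact ⟨n, q, hn, hq.1⟩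
  · rintro ⟨n, q, hq, hV⟩
    have hz := reachIn_subset R z U n hq
    have : ∃ p ∈ U ∩ z, Relation.ReflTransGen (fun a b => a ∈ z ∧ b ∈ z ∧ R a b) p q := by
      clear hV
      induction n generalizing q with
      | zero => exact ⟨q, hq, .refl⟩
      | succ n ih =>
        obtain ⟨hqz, p, hp, hR⟩ := hq
        have hpz := reachIn_subset R z U n hp
        obtain ⟨a, ha, h⟩ := ih p hp hpz
        exact ⟨a, ha, h.tail ⟨hpz, hqz, hR⟩⟩
    obtain ⟨p, hp, h⟩ := this
    exact ⟨p, hp, q, ⟨hV, hz⟩, h⟩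

theorem Linked.mono {X : Type*} {R : X → X → Prop} {z z' U V : Set X} (h : z ⊆ z')
    (hl : Linked R z U V) : Linked R z' U V := by
  obtain ⟨p, hp, q, hq, hpq⟩ := hl
  exact ⟨p, ⟨hp.1, h hp.2⟩, q, ⟨hq.1, h hq.2⟩,
    Relation.ReflTransGen.mono (fun a b hab => ⟨h hab.1, h hab.2.1, hab.2.2⟩) _ _ hpq⟩

/-- If the events that a random set hits a given open set are measurable, then so is the event that
two given open sets are linked through the random set by an open relation. -/
theorem measurableSet_linked {Ω X : Type*} [TopologicalSpace X] [SecondCountableTopology X]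
    (m : MeasurableSpace Ω) {R : X → X → Prop} (hR : IsOpen {p : X × X | R p.1 p.2})
    (ζ : Ω → Set X) (hζ : ∀ O : Set X, IsOpen O → MeasurableSet[m] {ω | (ζ ω ∩ O).Nonempty})
    {U V : Set X} (hU : IsOpen U) (hV : IsOpen V) :
    MeasurableSet[m] {ω | Linked R (ζ ω) U V} := by
  have key : ∀ (n : ℕ) (V : Set X), IsOpen V →
      MeasurableSet[m] {ω | (reachIn R (ζ ω) U n ∩ V).Nonempty} := by
    intro n
    induction n with
    | zero =>
      intro V hV
      convert hζ (U ∩ V) (hU.inter hV) using 3 with ω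
      simp only [reachIn]
      congr! 1
      ext; simp; tauto
    | succ n ih =>
      intro V hV
      have hb := TopologicalSpace.isBasis_countableBasis X
      have hc := TopologicalSpace.countable_countableBasis X
      -- As `R` is open, its last link lies in a basic rectangle `O × O'` contained in `R`. That
      -- containment does not depend on `ω`, so only countably many hitting events remain.
      have : {ω | (reachIn R (ζ ω) U (n + 1) ∩ V).Nonempty} =
          ⋃ O ∈ TopologicalSpace.countableBasis X, ⋃ O' ∈ TopologicalSpace.countableBasis X,
            {ω | (∀ a ∈ O, ∀ b ∈ O', R a b) ∧ (reachIn R (ζ ω) U n ∩ O).Nonempty ∧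
              (ζ ω ∩ (O' ∩ V)).Nonempty} := by
        ext ω
        simp only [Set.mem_ofPred_eq, Set.mem_iUnion, exists_prop]
        constructor
        · rintro ⟨q, ⟨hqz, p, hp, hpq⟩, hqV⟩
          obtain ⟨s, hs, hps, hsR⟩ := (hb.prod hb).exists_subset_of_mem_open
            (show (p, q) ∈ {p : X × X | R p.1 p.2} from hpq) hR
          obtain ⟨O, hO, O', hO', rfl⟩ := hs
          exact ⟨O, hO, O', hO', fun a ha b hb => hsR (Set.mk_mem_prod ha hb),
            ⟨p, hp, hps.1⟩, ⟨q, hqz, hps.2, hqV⟩⟩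
        · rintro ⟨O, -, O', -, hOR, ⟨p, hp, hpO⟩, ⟨q, hq, hqO, hqV⟩⟩
          exact ⟨q, ⟨hq, p, hp, hOR p hpO q hqO⟩, hqV⟩
      rw [this]
      refine MeasurableSet.biUnion hc fun O hO => MeasurableSet.biUnion hc fun O' hO' => ?_
      exact (MeasurableSet.const _).inter
        ((ih O (hb.isOpen hO)).inter (hζ _ ((hb.isOpen hO').inter hV)))
  have : {ω | Linked R (ζ ω) U V} = ⋃ n, {ω | (reachIn R (ζ ω) U n ∩ V).Nonempty} := by
    ext ω
    simp [linked_iff_exists_reachIn]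
  rw [this]
  exact MeasurableSet.iUnion fun n => key n V hV

/-! ### The cluster described by chains of touching balls. -/

variable {d : ℕ}

/-- The balls attached to two marked points intersect. -/
def Touch (p q : Marked d) : Prop :=
  (Metric.ball p.1 (p.2 : ℝ) ∩ Metric.ball q.1 (q.2 : ℝ)).Nonempty

theorem Touch.symm {p q : Marked d} (h : Touch p q) : Touch q p := by
  unfold Touch at *
  rwa [Set.inter_comm]

theorem Touch.dist_lt {p q : Marked d} (h : Touch p q) :
    dist p.1 q.1 < (p.2 : ℝ) + q.2 := by
  obtain ⟨y, hp, hq⟩ := h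
  rw [Metric.mem_ball] at hp hq
  linarith [dist_triangle_left p.1 q.1 y]

theorem isOpen_setOf_mem_ball (x : EuclideanSpace ℝ (Fin d)) :
    IsOpen {p : Marked d | x ∈ Metric.ball p.1 (p.2 : ℝ)} := by
  simp only [Metric.mem_ball]
  exact isOpen_lt (by fun_prop) (by fun_prop)

theorem isOpen_touch : IsOpen {p : Marked d × Marked d | Touch p.1 p.2} := by
  have : {p : Marked d × Marked d | Touch p.1 p.2} =
      ⋃ y, {p : Marked d | y ∈ Metric.ball p.1 (p.2 : ℝ)} ×ˢ
        {p : Marked d | y ∈ Metric.ball p.1 (p.2 : ℝ)} := by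
    ext p
    simp [Touch, Set.Nonempty]
  rw [this]
  exact isOpen_iUnion fun y => (isOpen_setOf_mem_ball y).prod (isOpen_setOf_mem_ball y)

/-- The balls reachable from the origin and the remaining balls have disjoint open unions, so a
connected set containing `0` stays in the first. Conversely, successive balls of a chain are
connected and overlap. No local finiteness is needed. -/
theorem mem_cluster_iff (z : Set (Marked d)) (x : EuclideanSpace ℝ (Fin d)) :
    x ∈ cluster z ↔ Linked Touch z {p | 0 ∈ Metric.ball p.1 (p.2 : ℝ)}
      {p | x ∈ Metric.ball p.1 (p.2 : ℝ)} := by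
  have hsub : ∀ p ∈ z, Metric.ball p.1 (p.2 : ℝ) ⊆ occupied z := fun p hp =>
    Set.subset_biUnion_of_mem (u := fun p : Marked d => Metric.ball p.1 (p.2 : ℝ)) hp
  have hconn : ∀ p : Marked d, IsPreconnected (Metric.ball p.1 (p.2 : ℝ)) := fun p =>
    (convex_ball _ _).isPreconnected
  constructor
  · intro hx
    have h0 : (0 : EuclideanSpace ℝ (Fin d)) ∈ occupied z := by
      by_contra h
      rw [cluster, connectedComponentIn_eq_empty h] at hx
      exact hx
    set good : Set (Marked d) := {q | q ∈ z ∧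
      ∃ p ∈ {p : Marked d | 0 ∈ Metric.ball p.1 (p.2 : ℝ)} ∩ z, Relation.ReflTransGen (fun a b => a ∈ z ∧ b ∈ z ∧ Touch a b) p q}
    have hopen : ∀ s : Set (Marked d), IsOpen (⋃ q ∈ s, Metric.ball q.1 (q.2 : ℝ)) := fun s =>
      isOpen_biUnion fun q _ => Metric.isOpen_ball
    have hdisj : Disjoint (⋃ q ∈ good, Metric.ball q.1 (q.2 : ℝ))
        (⋃ q ∈ z \ good, Metric.ball q.1 (q.2 : ℝ)) := by
      rw [Set.disjoint_left]
      intro y hy hy'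
      simp only [Set.mem_iUnion, exists_prop] at hy hy'
      obtain ⟨q, ⟨hqz, p, hp, hpq⟩, hyq⟩ := hy
      obtain ⟨q', ⟨hq'z, hq'⟩, hyq'⟩ := hy'
      exact hq' ⟨hq'z, p, hp, hpq.tail ⟨hqz, hq'z, y, hyq, hyq'⟩⟩
    have hcover : cluster z ⊆ (⋃ q ∈ good, Metric.ball q.1 (q.2 : ℝ)) ∪
        (⋃ q ∈ z \ good, Metric.ball q.1 (q.2 : ℝ)) := by
      intro y hy
      have hy' := connectedComponentIn_subset _ _ hy
      simp only [occupied, Set.mem_iUnion, exists_prop] at hy'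
      obtain ⟨q, hq, hyq⟩ := hy'
      by_cases hqg : q ∈ good
      · exact Or.inl (Set.mem_biUnion hqg hyq)
      · exact Or.inr (Set.mem_biUnion (show q ∈ z \ good from ⟨hq, hqg⟩) hyq)
    have hleft : (cluster z ∩ ⋃ q ∈ good, Metric.ball q.1 (q.2 : ℝ)).Nonempty := by
      refine ⟨0, mem_connectedComponentIn h0, ?_⟩
      simp only [occupied, Set.mem_iUnion, exists_prop] at h0
      obtain ⟨q, hq, h0q⟩ := h0
      exact Set.mem_biUnion (show q ∈ good from ⟨hq, q, ⟨h0q, hq⟩, .refl⟩) h0q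
    have hxg := isPreconnected_connectedComponentIn.subset_left_of_subset_union (hopen _) (hopen _)
      hdisj hcover hleft hx
    simp only [Set.mem_iUnion, exists_prop] at hxg
    obtain ⟨q, ⟨hqz, p, hp, hpq⟩, hxq⟩ := hxg
    exact ⟨p, hp, q, ⟨hxq, hqz⟩, hpq⟩
  · rintro ⟨p, ⟨hp0, hpz⟩, q, ⟨hxq, hqz⟩, h⟩
    suffices Metric.ball q.1 (q.2 : ℝ) ⊆ cluster z from this hxq
    clear hxq hqz
    induction h with
    | refl => exact (hconn p).subset_connectedComponentIn hp0 (hsub p hpz)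
    | tail _ h ih =>
      obtain ⟨-, hc, y, hyb, hyc⟩ := h
      rw [cluster, connectedComponentIn_eq (ih hyb)]
      exact (hconn _).subset_connectedComponentIn hyc (hsub _ hc)

theorem lt_clusterRadius_iff (z : Set (Marked d)) (a : ℝ≥0∞) :
    a < clusterRadius z ↔ Linked Touch z {p | 0 ∈ Metric.ball p.1 (p.2 : ℝ)}
      {p | ∃ x ∈ Metric.ball p.1 (p.2 : ℝ), a < ‖x‖ₑ} := by
  simp only [clusterRadius, lt_iSup_iff, mem_cluster_iff, exists_prop]
  constructor
  · rintro ⟨x, ⟨p, hp, q, ⟨hxq, hq⟩, h⟩, hx⟩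
    exact ⟨p, hp, q, ⟨⟨x, hxq, hx⟩, hq⟩, h⟩
  · rintro ⟨p, hp, q, ⟨⟨x, hxq, hx⟩, hq⟩, h⟩
    exact ⟨x, ⟨p, hp, q, ⟨hxq, hq⟩, h⟩, hx⟩

theorem clusterRadius_eq_top_of_percolates {z : Set (Marked d)} (h : Percolates z) :
    clusterRadius z = ⊤ := by
  by_contra hne
  refine h (isBounded_iff_forall_norm_le.2 ⟨(clusterRadius z).toReal, fun x hx => ?_⟩)
  have : ‖x‖ₑ ≤ clusterRadius z := le_iSup₂ (f := fun x (_ : x ∈ cluster z) => ‖x‖ₑ) x hx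
  simpa using ENNReal.toReal_mono hne this

theorem isOpen_setOf_exists_mem_ball_lt (a : ℝ≥0∞) :
    IsOpen {p : Marked d | ∃ x ∈ Metric.ball p.1 (p.2 : ℝ), a < ‖x‖ₑ} := by
  have : {p : Marked d | ∃ x ∈ Metric.ball p.1 (p.2 : ℝ), a < ‖x‖ₑ} =
      ⋃ x ∈ {x : EuclideanSpace ℝ (Fin d) | a < ‖x‖ₑ},
        {p : Marked d | x ∈ Metric.ball p.1 (p.2 : ℝ)} := by
    ext p
    simp only [Set.mem_ofPred_eq, Set.mem_iUnion, exists_prop]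
    exact exists_congr fun x => and_comm
  rw [this]
  exact isOpen_biUnion fun x _ => isOpen_setOf_mem_ball x

/-! ### Local crossings and the deterministic passage between scales. -/

/-- The marked points that can take part in a local crossing around `x` at scale `α`. -/
def window (x : EuclideanSpace ℝ (Fin d)) (α : ℝ) : Set (Marked d) :=
  {p | dist p.1 x < 3 * α ∧ (p.2 : ℝ) ≤ α / 2}

/-- The marked points carrying a ball that is large at scale `α` and not far from `x` with respect
to its own radius. -/
def large (x : EuclideanSpace ℝ (Fin d)) (α : ℝ) : Set (Marked d) :=
  {p | α / 2 < (p.2 : ℝ) ∧ dist p.1 x < 60 * p.2}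

/-- A chain of small balls crosses, inside the window, the annulus around `x` with radii `α` and
`2 * α`. -/
def Crossing (z : Set (Marked d)) (x : EuclideanSpace ℝ (Fin d)) (α : ℝ) : Prop :=
  Linked Touch (z ∩ window x α) {p | dist p.1 x < α} {p | 2 * α < dist p.1 x}

theorem Crossing.mono {z z' : Set (Marked d)} {x : EuclideanSpace ℝ (Fin d)} {α : ℝ}
    (h : z ⊆ z') (hc : Crossing z x α) : Crossing z' x α :=
  Linked.mono (Set.inter_subset_inter_left _ h) hc

/-- A chain of balls that starts near `x` either makes a local crossing, or meets a large ball, or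
stays near `x`. -/
theorem crossing_or_large_or_dist_le {z : Set (Marked d)} {x : EuclideanSpace ℝ (Fin d)} {α : ℝ}
    (hα : 0 < α) {p q : Marked d} (hpz : p ∈ z) (hpx : dist p.1 x < α) (hpr : (p.2 : ℝ) ≤ α / 2)
    (h : Relation.ReflTransGen (fun a b => a ∈ z ∧ b ∈ z ∧ Touch a b) p q) :
    Crossing z x α ∨ (z ∩ large x α).Nonempty ∨ dist q.1 x ≤ 2 * α := by
  have hpw : p ∈ z ∩ window x α := ⟨hpz, by linarith, hpr⟩
  suffices Crossing z x α ∨ (z ∩ large x α).Nonempty ∨ (dist q.1 x ≤ 2 * α ∧ q ∈ z ∩ window x α ∧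
      Relation.ReflTransGen
        (fun a b => a ∈ z ∩ window x α ∧ b ∈ z ∩ window x α ∧ Touch a b) p q) by
    tauto
  induction h with
  | refl => exact Or.inr (Or.inr ⟨by linarith, hpw, .refl⟩)
  | @tail b c _ h ih =>
    rcases ih with ih | ih | ⟨hbx, hbw, hpb⟩
    · exact Or.inl ih
    · exact Or.inr (Or.inl ih)
    have hd := h.2.2.dist_lt
    have ht := dist_triangle_left c.1 x b.1
    have hbr := hbw.2.2
    -- The previous centre is within `2 * α` of `x` and its radius is at most `α / 2`. A small next
    -- ball thus has its centre within `3 * α`, which is the window radius, and a large one is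
    -- within `6` times its own radius.
    by_cases hc : α / 2 < (c.2 : ℝ)
    · exact Or.inr (Or.inl ⟨c, h.2.1, hc, by linarith⟩)
    · have hcw : c ∈ z ∩ window x α := ⟨h.2.1, by linarith, by linarith⟩
      have hpc := hpb.tail ⟨hbw, hcw, h.2.2⟩
      by_cases hcx : dist c.1 x ≤ 2 * α
      · exact Or.inr (Or.inr ⟨hcx, hcw, hpc⟩)
      · exact Or.inl ⟨p, ⟨hpx, hpw⟩, c, ⟨not_le.1 hcx, hcw⟩, hpc⟩

/-- If both alternatives fail, the last ball of the chain has its centre within `2 * α` and radius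
at most `α / 2`, so it cannot reach beyond `4 * α`. -/
theorem crossing_or_large_of_lt_clusterRadius {z : Set (Marked d)} {α : ℝ} (hα : 0 < α)
    (h : ENNReal.ofReal (4 * α) < clusterRadius z) :
    Crossing z 0 α ∨ (z ∩ large 0 α).Nonempty := by
  obtain ⟨p, ⟨hp0, hpz⟩, q, ⟨⟨x, hxq, hx⟩, hq⟩, hpq⟩ := (lt_clusterRadius_iff _ _).1 h
  rw [← ofReal_norm, ENNReal.ofReal_lt_ofReal_iff_of_nonneg (by positivity)] at hx
  simp only [Set.mem_ofPred_eq, Metric.mem_ball] at hp0 hxq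
  rw [dist_comm] at hp0
  by_cases hpr : α / 2 < (p.2 : ℝ)
  · exact Or.inr ⟨p, hpz, hpr, by linarith⟩
  rcases crossing_or_large_or_dist_le (x := 0) hα hpz (by linarith) (not_lt.1 hpr) hpq
    with h | h | h
  · exact Or.inl h
  · exact Or.inr h
  by_cases hqr : α / 2 < (q.2 : ℝ)
  · exact Or.inr ⟨q, hq, hqr, by linarith⟩
  · have := dist_triangle x q.1 0
    rw [dist_zero_right] at this
    linarith

/-- A crossing at scale `10 * α` forces a large ball or two distant crossings at scale `α`. -/
theorem Crossing.exists_crossing {z : Set (Marked d)} {x : EuclideanSpace ℝ (Fin d)} {α : ℝ}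
    (hα : 0 < α) {t : Finset (EuclideanSpace ℝ (Fin d))}
    (ht : Metric.closedBall 0 30 ⊆ ⋃ k ∈ t, Metric.ball k 1) (h : Crossing z x (10 * α)) :
    (z ∩ large x α).Nonempty ∨ ∃ k ∈ t, ∃ l ∈ t,
      6 * α < dist (x + α • k) (x + α • l) ∧ Crossing z (x + α • k) α ∧
        Crossing z (x + α • l) α := by
  obtain ⟨p, ⟨hpx, hp⟩, q, ⟨hqx, hq⟩, hpq⟩ := h
  simp only [Set.mem_ofPred_eq] at hpx hqx
  by_cases hl : (z ∩ large x α).Nonempty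
  · exact Or.inl hl
  right
  -- A centre in this window is within `30 * α` of `x`, and `α` is less than twice a large radius;
  -- hence the factor `60` in `large`.
  have hsmall : ∀ b ∈ z ∩ window x (10 * α), (b.2 : ℝ) ≤ α / 2 := by
    intro b hb
    by_contra hbr
    rw [not_le] at hbr
    exact hl ⟨b, hb.1, hbr, by linarith [hb.2.1]⟩
  have hcov : ∀ b ∈ z ∩ window x (10 * α), ∃ k ∈ t, dist b.1 (x + α • k) < α := by
    intro b hb
    have hb1 : α⁻¹ • (b.1 - x) ∈ Metric.closedBall (0 : EuclideanSpace ℝ (Fin d)) 30 := by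
      rw [mem_closedBall_zero_iff, norm_smul, Real.norm_of_nonneg (by positivity), ← dist_eq_norm,
        inv_mul_le_iff₀ hα]
      linarith [hb.2.1]
    have hb2 := ht hb1
    simp only [Set.mem_iUnion, exists_prop, Metric.mem_ball] at hb2
    obtain ⟨k, hk, hbk⟩ := hb2
    refine ⟨k, hk, ?_⟩
    have : b.1 - (x + α • k) = α • (α⁻¹ • (b.1 - x) - k) := by
      rw [smul_sub, smul_inv_smul₀ hα.ne']
      abel
    rw [dist_eq_norm, this, norm_smul, Real.norm_of_nonneg hα.le, ← dist_eq_norm]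
    nlinarith
  have hsymm : Relation.ReflTransGen (fun a b => a ∈ z ∩ window x (10 * α) ∧
      b ∈ z ∩ window x (10 * α) ∧ Touch a b) q p :=
    haveI : Std.Symm (fun a b : Marked d => a ∈ z ∩ window x (10 * α) ∧
      b ∈ z ∩ window x (10 * α) ∧ Touch a b) :=
      ⟨fun a b hab => ⟨hab.2.1, hab.1, hab.2.2.symm⟩⟩
    symm hpq
  have hcross : ∀ (a b : Marked d) (y : EuclideanSpace ℝ (Fin d)), a ∈ z ∩ window x (10 * α) →
      dist a.1 y < α → 2 * α < dist b.1 y →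
      Relation.ReflTransGen (fun a b => a ∈ z ∩ window x (10 * α) ∧
        b ∈ z ∩ window x (10 * α) ∧ Touch a b) a b → Crossing z y α := by
    intro a b y ha hay hby hab
    rcases crossing_or_large_or_dist_le hα ha hay (hsmall a ha) hab with h | ⟨c, hc, hcr, -⟩ | h
    · exact h.mono Set.inter_subset_left
    · exact absurd hcr (not_lt.2 (hsmall c hc))
    · exact absurd hby (not_lt.2 h)
  -- The chain's ends are more than `10 * α` apart and each is within `α` of its net point. The net
  -- points are thus more than `8 * α` apart, and each end is more than `9 * α` from the other's net
  -- point. Reading the chain in both directions gives the two crossings.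
  obtain ⟨k, hk, hpk⟩ := hcov p hp
  obtain ⟨l, hlt, hql⟩ := hcov q hq
  have h1 := dist_triangle q.1 p.1 x
  have h2 := dist_triangle_right q.1 p.1 (x + α • k)
  have h3 := dist_triangle_right q.1 p.1 (x + α • l)
  have h4 := dist_triangle q.1 (x + α • l) (x + α • k)
  rw [dist_comm (x + α • l)] at h4
  exact ⟨k, hk, l, hlt, by linarith, hcross p q _ hp hpk (by linarith) hpq,
    hcross q p _ hq hql (by linarith) hsymm⟩


/-! ### Hitting probabilities and independence for Poisson processes. -/

section PointProcess

/-- The events that a random set has no point in a measurable subset of `W`. -/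
def voidEvents {Ω X : Type*} [MeasurableSpace X] (ξ : Ω → Set X) (W : Set X) : Set (Set Ω) :=
  {s | ∃ B, MeasurableSet B ∧ B ⊆ W ∧ s = {ω | ξ ω ∩ B = ∅}}

theorem isPiSystem_voidEvents {Ω X : Type*} [MeasurableSpace X] (ξ : Ω → Set X) (W : Set X) :
    IsPiSystem (voidEvents ξ W) := by
  rintro _ ⟨B, hB, hBW, rfl⟩ _ ⟨B', hB', hBW', rfl⟩ -
  refine ⟨B ∪ B', hB.union hB', Set.union_subset hBW hBW', ?_⟩
  ext ω
  simp [Set.inter_union_distrib_left]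

theorem setOf_inter_eq_empty {Ω X : Type*} (ξ : Ω → Set X) (B : Set X) :
    {ω | ξ ω ∩ B = ∅} = pointCount ξ B ⁻¹' {0} := by
  ext ω
  simp [pointCount]

variable {Ω X : Type*} [MeasurableSpace Ω] [MeasurableSpace X] {ξ : Ω → Set X} {μ : Measure X}
  {P : Measure Ω}

theorem IsPoissonPointProcess.measurableSet_void (h : IsPoissonPointProcess ξ μ P) {B : Set X}
    (hB : MeasurableSet B) : MeasurableSet {ω | ξ ω ∩ B = ∅} := by
  rw [setOf_inter_eq_empty]
  exact h.measurable_pointCount B hB (measurableSet_singleton 0)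

theorem IsPoissonPointProcess.measurableSet_hit (h : IsPoissonPointProcess ξ μ P) {B : Set X}
    (hB : MeasurableSet B) : MeasurableSet {ω | (ξ ω ∩ B).Nonempty} := by
  convert (h.measurableSet_void hB).compl using 1
  ext ω
  simp [Set.nonempty_iff_ne_empty]

/-- For finite mass `m` this is `1 - exp (-m) ≤ m`. -/
theorem IsPoissonPointProcess.measure_hit_le [IsProbabilityMeasure P]
    (h : IsPoissonPointProcess ξ μ P) {B : Set X} (hB : MeasurableSet B) :
    P {ω | (ξ ω ∩ B).Nonempty} ≤ μ B := by
  by_cases hμ : μ B = ∞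
  · simp [hμ]
  lift μ B to ℝ≥0 using hμ with m hm
  have hvoid : P {ω | ξ ω ∩ B = ∅} = ENNReal.ofReal (Real.exp (-m)) := by
    rw [setOf_inter_eq_empty, ← Measure.map_apply (h.measurable_pointCount B hB)
      (measurableSet_singleton 0), h.map_pointCount B hB m hm.symm,
      Measure.map_apply (measurable_of_countable _) (measurableSet_singleton 0)]
    have : (fun k : ℕ => (k : ℕ∞)) ⁻¹' {0} = {0} := by ext; simp
    rw [this, poissonMeasure_singleton]
    simp
  have hcompl : {ω | (ξ ω ∩ B).Nonempty} = {ω | ξ ω ∩ B = ∅}ᶜ := by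
    ext ω
    simp [Set.nonempty_iff_ne_empty]
  rw [hcompl, prob_compl_eq_one_sub (h.measurableSet_void hB), hvoid, tsub_le_iff_right,
    ← ENNReal.ofReal_coe_nnreal, ← ENNReal.ofReal_add m.coe_nonneg (Real.exp_nonneg _),
    ENNReal.one_le_ofReal]
  linarith [Real.add_one_le_exp (-(m : ℝ))]

/-- What a Poisson point process does in two disjoint regions is independent, as far as void
events are concerned. -/
theorem IsPoissonPointProcess.indep_voidEvents [IsProbabilityMeasure P]
    (h : IsPoissonPointProcess ξ μ P) {W W' : Set X} (hW : Disjoint W W') :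
    Indep (MeasurableSpace.generateFrom (voidEvents ξ W))
      (MeasurableSpace.generateFrom (voidEvents ξ W')) P := by
  -- Void events form a π-system, so the product rule for one pair of disjoint regions suffices.
  refine IndepSets.indep' ?_ ?_ (isPiSystem_voidEvents ξ W) (isPiSystem_voidEvents ξ W') ?_
  · rintro _ ⟨B, hB, -, rfl⟩
    exact h.measurableSet_void hB
  · rintro _ ⟨B, hB, -, rfl⟩
    exact h.measurableSet_void hB
  · rw [IndepSets_iff]
    rintro _ _ ⟨B, hB, hBW, rfl⟩ ⟨B', hB', hBW', rfl⟩
    have hd := hW.mono hBW hBW'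
    have hi := h.iIndepFun_pointCount 2 ![B, B'] (by intro i; fin_cases i <;> assumption) (by
      intro i j hij
      fin_cases i <;> fin_cases j
      · exact absurd rfl hij
      · exact hd
      · exact hd.symm
      · exact absurd rfl hij)
    have h01 : IndepFun (pointCount ξ B) (pointCount ξ B') P :=
      hi.indepFun (i := 0) (j := 1) (by decide)
    rw [setOf_inter_eq_empty, setOf_inter_eq_empty]
    exact h01.measure_inter_preimage_eq_mul _ _ (measurableSet_singleton 0)
      (measurableSet_singleton 0)

end PointProcess

/-! ### The recursive inequality for crossing probabilities. -/

theorem measurableSet_window (x : EuclideanSpace ℝ (Fin d)) (α : ℝ) :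
    MeasurableSet (window x α) :=
  (measurableSet_lt (f := fun p : Marked d => dist p.1 x) (g := fun _ => 3 * α)
    (by fun_prop) (by fun_prop)).inter
    (measurableSet_le (f := fun p : Marked d => (p.2 : ℝ)) (g := fun _ => α / 2)
    (by fun_prop) (by fun_prop))

theorem measurableSet_large (x : EuclideanSpace ℝ (Fin d)) (α : ℝ) :
    MeasurableSet (large x α) :=
  (measurableSet_lt (f := fun _ => α / 2) (g := fun p : Marked d => (p.2 : ℝ))
    (by fun_prop) (by fun_prop)).inter
    (measurableSet_lt (f := fun p : Marked d => dist p.1 x) (g := fun p => 60 * (p.2 : ℝ))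
    (by fun_prop) (by fun_prop))

/-- A crossing depends only on the points in its window. Measurability for this small σ-algebra is
what makes crossings in disjoint windows independent. -/
theorem measurableSet_crossing {Ω : Type*} [MeasurableSpace Ω] (ξ : Ω → Set (Marked d))
    (x : EuclideanSpace ℝ (Fin d)) (α : ℝ) :
    MeasurableSet[MeasurableSpace.generateFrom (voidEvents ξ (window x α))]
      {ω | Crossing (ξ ω) x α} := by
  refine measurableSet_linked _ isOpen_touch (fun ω => ξ ω ∩ window x α) ?_ ?_ ?_
  · intro O hO
    have : {ω | (ξ ω ∩ window x α ∩ O).Nonempty} = {ω | ξ ω ∩ (window x α ∩ O) = ∅}ᶜ := by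
      ext ω
      simp [Set.nonempty_iff_ne_empty, Set.inter_assoc]
    rw [this]
    refine MeasurableSet.compl (MeasurableSpace.measurableSet_generateFrom ?_)
    exact ⟨_, (measurableSet_window x α).inter hO.measurableSet, Set.inter_subset_left, rfl⟩
  · exact isOpen_lt (by fun_prop) (by fun_prop)
  · exact isOpen_lt (by fun_prop) (by fun_prop)

theorem disjoint_window {x y : EuclideanSpace ℝ (Fin d)} {α : ℝ} (h : 6 * α < dist x y) :
    Disjoint (window x α) (window y α) := by
  rw [Set.disjoint_left]
  intro p hx hy
  linarith [hx.1, hy.1, dist_triangle_left x y p.1]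

variable {Ω : Type*} [MeasurableSpace Ω] {P : Measure Ω} {ξ : Ω → Set (Marked d)}

theorem IsPoissonPointProcess.measurable_clusterRadius {μ : Measure (Marked d)}
    (h : IsPoissonPointProcess ξ μ P) : Measurable fun ω => clusterRadius (ξ ω) := by
  refine measurable_of_Ioi fun a => ?_
  have : (fun ω => clusterRadius (ξ ω)) ⁻¹' Set.Ioi a =
      {ω | Linked Touch (ξ ω) {p | 0 ∈ Metric.ball p.1 (p.2 : ℝ)}
      {p | ∃ x ∈ Metric.ball p.1 (p.2 : ℝ), a < ‖x‖ₑ}} := by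
    ext ω
    exact lt_clusterRadius_iff _ _
  rw [this]
  exact measurableSet_linked _ isOpen_touch ξ (fun O hO => h.measurableSet_hit hO.measurableSet)
    (isOpen_setOf_mem_ball 0) (isOpen_setOf_exists_mem_ball_lt a)

/-- A union bound over pairs of net points: distant pairs have disjoint windows and contribute at
most `a ^ 2` by independence. A bound uniform in the centre takes the place of stationarity. -/
theorem IsPoissonPointProcess.measureReal_crossing_le [IsProbabilityMeasure P] {μ : Measure (Marked d)}
    (h : IsPoissonPointProcess ξ μ P) {α a : ℝ} (hα : 0 < α)
    {t : Finset (EuclideanSpace ℝ (Fin d))}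
    (ht : Metric.closedBall 0 30 ⊆ ⋃ k ∈ t, Metric.ball k 1)
    (ha : ∀ y, P.real {ω | Crossing (ξ ω) y α} ≤ a) (x : EuclideanSpace ℝ (Fin d)) :
    P.real {ω | Crossing (ξ ω) x (10 * α)} ≤
      P.real {ω | (ξ ω ∩ large x α).Nonempty} + (t.card : ℝ) ^ 2 * a ^ 2 := by
  have ha0 : 0 ≤ a := measureReal_nonneg.trans (ha 0)
  set E : EuclideanSpace ℝ (Fin d) → EuclideanSpace ℝ (Fin d) → Set Ω := fun k l =>
    {ω | 6 * α < dist (x + α • k) (x + α • l) ∧ Crossing (ξ ω) (x + α • k) α ∧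
      Crossing (ξ ω) (x + α • l) α} with hE
  have hEle : ∀ k l, P.real (E k l) ≤ a ^ 2 := by
    intro k l
    by_cases hkl : 6 * α < dist (x + α • k) (x + α • l)
    · have hi := (Indep_iff _ _ _).1 (h.indep_voidEvents (disjoint_window hkl)) _ _
        (measurableSet_crossing ξ _ α) (measurableSet_crossing ξ _ α)
      have hEeq : E k l = {ω | Crossing (ξ ω) (x + α • k) α} ∩
          {ω | Crossing (ξ ω) (x + α • l) α} := by
        ext ω
        exact and_iff_right hkl
      rw [hEeq, measureReal_def, hi, ENNReal.toReal_mul, sq]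
      exact mul_le_mul (ha _) (ha _) measureReal_nonneg ha0
    · have hEeq : E k l = ∅ := Set.eq_empty_of_forall_notMem fun ω hω => hkl hω.1
      rw [hEeq]
      simp only [measureReal_empty]
      positivity
  have hsub : {ω | Crossing (ξ ω) x (10 * α)} ⊆
      {ω | (ξ ω ∩ large x α).Nonempty} ∪ ⋃ k ∈ t, ⋃ l ∈ t, E k l := by
    intro ω hω
    rcases hω.exists_crossing hα ht with h | ⟨k, hk, l, hl, h⟩
    · exact Or.inl h
    · exact Or.inr (Set.mem_biUnion (Finset.mem_coe.2 hk)
        (Set.mem_biUnion (Finset.mem_coe.2 hl) h))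
  calc P.real {ω | Crossing (ξ ω) x (10 * α)}
      ≤ P.real ({ω | (ξ ω ∩ large x α).Nonempty} ∪ ⋃ k ∈ t, ⋃ l ∈ t, E k l) :=
        measureReal_mono hsub
    _ ≤ P.real {ω | (ξ ω ∩ large x α).Nonempty} + P.real (⋃ k ∈ t, ⋃ l ∈ t, E k l) :=
        measureReal_union_le _ _
    _ ≤ P.real {ω | (ξ ω ∩ large x α).Nonempty} + ∑ k ∈ t, ∑ l ∈ t, P.real (E k l) := by
        gcongr
        exact (measureReal_biUnion_finset_le _ _).trans
          (Finset.sum_le_sum fun k _ => measureReal_biUnion_finset_le _ _)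
    _ ≤ P.real {ω | (ξ ω ∩ large x α).Nonempty} + ∑ k ∈ t, ∑ l ∈ t, a ^ 2 := by
        gcongr
        exact hEle _ _
    _ = _ := by
        simp only [Finset.sum_const, nsmul_eq_mul]
        ring

/-! ### Intensity of the large balls and of the windows. -/

/-- The mass of `r ^ d ν(dr)` on the radii that are large at scale `α`. -/
noncomputable def tailMoment (d : ℕ) (ν : Measure (Set.Ioi (0 : ℝ))) (α : ℝ) : ℝ≥0∞ :=
  ∫⁻ r in {r : Set.Ioi (0 : ℝ) | α / 2 < r}, ENNReal.ofReal ((r : ℝ) ^ d) ∂ν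

theorem measurableSet_setOf_half_lt (α : ℝ) :
    MeasurableSet {r : Set.Ioi (0 : ℝ) | α / 2 < r} :=
  measurableSet_lt (by fun_prop) (by fun_prop)

/-- For a fixed large radius `r` the admissible centres fill a ball of radius `60 * r`, of volume
proportional to `r ^ d`. This is where the moment of order `d` enters. -/
theorem intensity_large (lam : ℝ≥0) (ν : Measure (Set.Ioi (0 : ℝ))) [IsProbabilityMeasure ν]
    (x : EuclideanSpace ℝ (Fin d)) (α : ℝ) :
    intensity d lam ν (large x α) =
      lam * (60 ^ d * volume (Metric.ball (0 : EuclideanSpace ℝ (Fin d)) 1)) *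
        tailMoment d ν α := by
  rw [intensity, Measure.prod_apply_symm (measurableSet_large x α), tailMoment,
    ← lintegral_indicator (measurableSet_setOf_half_lt α), ← lintegral_const_mul]
  · congr! 2 with r
    have hr : (0 : ℝ) < 60 * (r : ℝ) := mul_pos (by norm_num) r.2
    by_cases hα : α / 2 < (r : ℝ)
    · have : (fun y : EuclideanSpace ℝ (Fin d) => (y, r)) ⁻¹' large x α =
          Metric.ball x (60 * r) := by
        ext y
        simp [large, hα]
      rw [this, Set.indicator_of_mem (by exact hα), Measure.smul_apply,
        Measure.addHaar_ball_of_pos _ _ hr, finrank_euclideanSpace_fin, mul_pow,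
        ENNReal.ofReal_mul (by positivity), ENNReal.ofReal_pow (by norm_num)]
      simp only [ENNReal.ofReal_ofNat, ENNReal.smul_def, smul_eq_mul]
      ring
    · have : (fun y : EuclideanSpace ℝ (Fin d) => (y, r)) ⁻¹' large x α = ∅ := by
        ext y
        simp [large, hα]
      rw [this, Set.indicator_of_notMem (by exact hα)]
      simp
  · exact (by fun_prop : Measurable fun r : Set.Ioi (0 : ℝ) =>
      ENNReal.ofReal ((r : ℝ) ^ d)).indicator (measurableSet_setOf_half_lt α)

theorem intensity_window_le (lam : ℝ≥0) (ν : Measure (Set.Ioi (0 : ℝ))) [IsProbabilityMeasure ν]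
    (x : EuclideanSpace ℝ (Fin d)) {α : ℝ} (hα : 0 < α) :
    intensity d lam ν (window x α) ≤
      lam * (ENNReal.ofReal ((3 * α) ^ d) *
        volume (Metric.ball (0 : EuclideanSpace ℝ (Fin d)) 1)) := by
  have : window x α ⊆ Metric.ball x (3 * α) ×ˢ Set.univ := fun p hp => ⟨hp.1, trivial⟩
  refine (measure_mono this).trans ?_
  rw [intensity, Measure.prod_prod, measure_univ, mul_one, Measure.smul_apply,
    Measure.addHaar_ball_of_pos _ _ (by positivity), finrank_euclideanSpace_fin]
  rfl


/-! ### The quadratic recursion. -/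

/-- The sequence that starts at `1 / 2` and satisfies `v (n + 1) = v n ^ 2 + h n`. -/
noncomputable def sqIter (h : ℕ → ℝ) : ℕ → ℝ
  | 0 => 1 / 2
  | n + 1 => sqIter h n ^ 2 + h n

section SqIter

variable {h : ℕ → ℝ}

theorem sqIter_nonneg (h0 : ∀ n, 0 ≤ h n) (n : ℕ) : 0 ≤ sqIter h n := by
  cases n with
  | zero => norm_num [sqIter]
  | succ n => exact add_nonneg (sq_nonneg _) (h0 n)

theorem sqIter_le_half (h0 : ∀ n, 0 ≤ h n) (h1 : ∀ n, h n ≤ 1 / 4) (n : ℕ) :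
    sqIter h n ≤ 1 / 2 := by
  induction n with
  | zero => exact le_rfl
  | succ n ih =>
    have := sqIter_nonneg h0 n
    rw [sqIter]
    nlinarith [h1 n]

/-- Below `1 / 2` squaring at least halves, so the recursion is a contraction by `1 / 2` with
vanishing forcing. -/
theorem tendsto_sqIter (h0 : ∀ n, 0 ≤ h n) (h1 : ∀ n, h n ≤ 1 / 4)
    (hlim : Filter.Tendsto h Filter.atTop (nhds 0)) :
    Filter.Tendsto (sqIter h) Filter.atTop (nhds 0) := by
  have hpow : Filter.Tendsto (fun n : ℕ => (1 / 2 : ℝ) ^ n) Filter.atTop (nhds 0) :=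
    tendsto_pow_atTop_nhds_zero_of_lt_one (by norm_num) (by norm_num)
  rw [Metric.tendsto_atTop] at hlim hpow ⊢
  intro ε hε
  obtain ⟨k, hk⟩ := hlim (ε / 4) (by positivity)
  obtain ⟨m, hm⟩ := hpow (ε / 2) (by positivity)
  have key : ∀ n, sqIter h (k + n) ≤ (1 / 2) ^ n + ε / 2 := by
    intro n
    induction n with
    | zero =>
      have := sqIter_le_half h0 h1 k
      simp only [add_zero, pow_zero]
      linarith
    | succ n ih =>
      have hn := hk (k + n) (by omega)
      rw [Real.dist_eq, sub_zero, abs_of_nonneg (h0 _)] at hn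
      have h2 := sqIter_le_half h0 h1 (k + n)
      have h3 := sqIter_nonneg h0 (k + n)
      rw [← add_assoc, sqIter, pow_succ (1 / 2 : ℝ) n]
      nlinarith
  refine ⟨k + m, fun n hn => ?_⟩
  have h2 := hm (n - k) (by omega)
  rw [Real.dist_eq, sub_zero, abs_of_nonneg (by positivity)] at h2
  have h3 := key (n - k)
  rw [show k + (n - k) = n by omega] at h3
  rw [Real.dist_eq, sub_zero, abs_of_nonneg (sqIter_nonneg h0 n)]
  linarith

/-- Summing the inequality lets half of each partial sum be absorbed on the left. -/
theorem summable_of_le_half_mul_add {a b : ℕ → ℝ} (ha : ∀ n, 0 ≤ a n) (hb : Summable b)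
    (hb0 : ∀ n, 0 ≤ b n) (hab : ∀ n, a (n + 1) ≤ 1 / 2 * a n + b n) : Summable a := by
  refine summable_of_sum_range_le (c := 2 * (a 0 + ∑' n, b n)) ha fun n => ?_
  have h1 : ∑ i ∈ Finset.range (n + 1), a i ≤
      (∑ i ∈ Finset.range n, (1 / 2 * a i + b i)) + a 0 := by
    rw [Finset.sum_range_succ']
    gcongr
    exact hab _
  rw [Finset.sum_add_distrib, ← Finset.mul_sum, Finset.sum_range_succ] at h1
  have h2 := hb.sum_le_tsum (Finset.range n) fun i _ => hb0 i
  linarith [ha n]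

/-- Once `v n < 1 / (2 * q)`, one has `q * v n ^ 2 ≤ v n / 2`, so the weight `q ^ n` no longer
spoils the contraction. -/
theorem summable_pow_mul_sqIter {q : ℝ} (hq : 1 ≤ q) (h0 : ∀ n, 0 ≤ h n) (h1 : ∀ n, h n ≤ 1 / 4)
    (hs : Summable fun n => q ^ n * h n) : Summable fun n => q ^ n * sqIter h n := by
  have hq0 : 0 < q := by linarith
  have hsh : Summable h := hs.of_nonneg_of_le h0 fun n =>
    le_mul_of_one_le_left (h0 n) (one_le_pow₀ hq)
  have hlim := tendsto_sqIter h0 h1 hsh.tendsto_atTop_zero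
  rw [Metric.tendsto_atTop] at hlim
  obtain ⟨k, hk⟩ := hlim (1 / (2 * q)) (by positivity)
  rw [← summable_nat_add_iff k]
  refine summable_of_le_half_mul_add (b := fun n => q * (q ^ (n + k) * h (n + k)))
    (fun n => mul_nonneg (by positivity) (sqIter_nonneg h0 _))
    (((summable_nat_add_iff k).2 hs).mul_left q)
    (fun n => mul_nonneg hq0.le (mul_nonneg (by positivity) (h0 _))) fun n => ?_
  have h2 := hk (n + k) (by omega)
  have h3 := sqIter_nonneg h0 (n + k)
  rw [Real.dist_eq, sub_zero, abs_of_nonneg h3, lt_div_iff₀ (by positivity)] at h2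
  rw [show n + 1 + k = n + k + 1 by omega, sqIter, pow_succ]
  have h4 : sqIter h (n + k) ^ 2 * q ≤ 1 / 2 * sqIter h (n + k) := by nlinarith
  have h5 : 0 ≤ q ^ (n + k) := by positivity
  nlinarith [mul_le_mul_of_nonneg_left h4 h5]

end SqIter

theorem sum_pow_ite_lt_le {q : ℝ} (hq : 1 < q) {y : ℝ} (hy : 0 ≤ y) (n : ℕ) :
    ∑ k ∈ Finset.range n, (if q ^ k < y then q ^ k else 0) ≤ q / (q - 1) * y := by
  have hq1 : 0 < q - 1 := by linarith
  induction n with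
  | zero => simpa using by positivity
  | succ n ih =>
    by_cases hn : q ^ n < y
    · calc ∑ k ∈ Finset.range (n + 1), (if q ^ k < y then q ^ k else 0)
          ≤ ∑ k ∈ Finset.range (n + 1), q ^ k := by
            refine Finset.sum_le_sum fun k _ => ?_
            split_ifs
            · exact le_rfl
            · positivity
        _ = (q ^ (n + 1) - 1) / (q - 1) := geom_sum_eq hq.ne' _
        _ ≤ q / (q - 1) * y := by
            rw [div_mul_eq_mul_div]
            gcongr
            rw [pow_succ]
            nlinarith
    · rw [Finset.sum_range_succ, if_neg hn, add_zero]
      exact ih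


/-! ### Tails of the moment of order `d`. -/

theorem moment_natCast (ν : Measure (Set.Ioi (0 : ℝ))) :
    moment ν d = ∫⁻ r, ENNReal.ofReal ((r : ℝ) ^ d) ∂ν := by
  simp [moment]

theorem tailMoment_le (ν : Measure (Set.Ioi (0 : ℝ))) (α : ℝ) :
    tailMoment d ν α ≤ moment ν d := by
  rw [moment_natCast]
  exact setLIntegral_le_lintegral _ _

theorem tendsto_tailMoment {ν : Measure (Set.Ioi (0 : ℝ))} (hν : moment ν d < ∞) {α : ℝ}
    (hα : 0 < α) :
    Filter.Tendsto (fun n : ℕ => tailMoment d ν (10 ^ n * α)) Filter.atTop (nhds 0) := by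
  set f : Set.Ioi (0 : ℝ) → ℝ≥0∞ := fun r => ENNReal.ofReal ((r : ℝ) ^ d)
  have hs : ∀ n : ℕ, MeasurableSet {r : Set.Ioi (0 : ℝ) | 10 ^ n * α / 2 < r} := fun n =>
    measurableSet_setOf_half_lt _
  have h := tendsto_measure_iInter_atTop (μ := ν.withDensity f)
    (s := fun n : ℕ => {r : Set.Ioi (0 : ℝ) | 10 ^ n * α / 2 < r})
    (fun n => (hs n).nullMeasurableSet) ?_ ⟨0, ?_⟩
  · have hempty : ⋂ n : ℕ, {r : Set.Ioi (0 : ℝ) | 10 ^ n * α / 2 < r} = ∅ := by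
      refine Set.eq_empty_of_forall_notMem fun r hr => ?_
      obtain ⟨n, hn⟩ := pow_unbounded_of_one_lt (2 * (r : ℝ) / α) (by norm_num : (1 : ℝ) < 10)
      have := Set.mem_iInter.1 hr n
      simp only [Set.mem_ofPred_eq] at this
      rw [div_lt_iff₀ hα] at hn
      linarith
    rw [hempty, measure_empty] at h
    refine h.congr fun n => ?_
    simp only [Function.comp_apply]
    rw [withDensity_apply _ (hs n)]
    rfl
  · intro m n hmn r hr
    simp only [Set.mem_ofPred_eq] at hr ⊢
    refine lt_of_le_of_lt ?_ hr
    gcongr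
    norm_num
  · rw [withDensity_apply _ (hs 0)]
    exact ((tailMoment_le ν _).trans_lt hν).ne

/-- Exchange sum and integral: a radius `r` counts only at scales with `10 ^ n < 2 * r / α`. Over
these the weights `10 ^ (s * n)` add up to at most a constant times `r ^ s`, which turns `r ^ d`
into `r ^ (d + s)`. -/
theorem summable_pow_mul_tailMoment {ν : Measure (Set.Ioi (0 : ℝ))} {s : ℝ} (hs : 0 < s)
    (hν : moment ν d < ∞) (hνs : moment ν (d + s) < ∞) {α : ℝ} (hα : 0 < α) :
    Summable fun n : ℕ => ((10 : ℝ) ^ s) ^ n * (tailMoment d ν (10 ^ n * α)).toReal := by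
  set q : ℝ := (10 : ℝ) ^ s with hq
  have hq1 : 1 < q := Real.one_lt_rpow (by norm_num) hs
  have hq2 : 0 < q - 1 := by linarith
  have hfin : ∀ n : ℕ, tailMoment d ν (10 ^ n * α) ≠ ∞ := fun n =>
    ((tailMoment_le ν _).trans_lt hν).ne
  set D : ℝ := q / (q - 1) * (2 / α) ^ s with hD
  have hD0 : 0 ≤ D := by positivity
  have hmeas : ∀ k : ℕ, Measurable ({r : Set.Ioi (0 : ℝ) | 10 ^ k * α / 2 < r}.indicator
      fun r => ENNReal.ofReal ((r : ℝ) ^ d)) := fun k =>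
    (by fun_prop : Measurable fun r : Set.Ioi (0 : ℝ) =>
      ENNReal.ofReal ((r : ℝ) ^ d)).indicator (measurableSet_setOf_half_lt _)
  have key : ∀ n : ℕ, ∑ k ∈ Finset.range n, ENNReal.ofReal (q ^ k) * tailMoment d ν (10 ^ k * α) ≤
      ENNReal.ofReal D * moment ν (d + s) := by
    intro n
    have h1 : ∑ k ∈ Finset.range n, ENNReal.ofReal (q ^ k) * tailMoment d ν (10 ^ k * α) =
        ∫⁻ r, ∑ k ∈ Finset.range n, ENNReal.ofReal (q ^ k) *
          {r : Set.Ioi (0 : ℝ) | 10 ^ k * α / 2 < r}.indicator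
            (fun r => ENNReal.ofReal ((r : ℝ) ^ d)) r ∂ν := by
      rw [lintegral_finsetSum _ fun k _ => (hmeas k).const_mul _]
      refine Finset.sum_congr rfl fun k _ => ?_
      rw [lintegral_const_mul _ (hmeas k), lintegral_indicator (measurableSet_setOf_half_lt _)]
      rfl
    rw [h1, moment, ← lintegral_const_mul' _ _ ENNReal.ofReal_ne_top]
    refine lintegral_mono fun r => ?_
    have hr : (0 : ℝ) < r := r.2
    have h2 : ∀ k : ℕ, (10 ^ k * α / 2 < (r : ℝ)) ↔ q ^ k < (2 * r / α) ^ s := by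
      intro k
      rw [hq, Real.rpow_pow_comm (by norm_num),
        Real.rpow_lt_rpow_iff (by positivity) (by positivity) hs, lt_div_iff₀ hα,
        div_lt_iff₀ (by norm_num), mul_comm (r : ℝ)]
    have h3 : ∀ k : ℕ, ENNReal.ofReal (q ^ k) *
        {r : Set.Ioi (0 : ℝ) | 10 ^ k * α / 2 < r}.indicator
          (fun r => ENNReal.ofReal ((r : ℝ) ^ d)) r =
        ENNReal.ofReal ((if q ^ k < (2 * r / α) ^ s then q ^ k else 0) * (r : ℝ) ^ d) := by
      intro k
      by_cases hk : 10 ^ k * α / 2 < (r : ℝ)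
      · rw [Set.indicator_of_mem (by exact hk), if_pos ((h2 k).1 hk),
          ENNReal.ofReal_mul (by positivity)]
      · rw [Set.indicator_of_notMem (by exact hk), if_neg (mt (h2 k).2 hk)]
        simp
    simp only [h3]
    rw [← ENNReal.ofReal_sum_of_nonneg, ← Finset.sum_mul, ← ENNReal.ofReal_mul hD0]
    · refine ENNReal.ofReal_le_ofReal ?_
      calc (∑ k ∈ Finset.range n, if q ^ k < (2 * (r : ℝ) / α) ^ s then q ^ k else 0) * (r : ℝ) ^ d
          ≤ (q / (q - 1) * (2 * r / α) ^ s) * (r : ℝ) ^ d := by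
            gcongr
            exact sum_pow_ite_lt_le hq1 (by positivity) n
        _ = D * (r : ℝ) ^ ((d : ℝ) + s) := by
            rw [hD, Real.rpow_add hr, Real.rpow_natCast, mul_div_right_comm,
              Real.mul_rpow (by positivity) hr.le]
            ring
    · intro k _
      split_ifs <;> positivity
  refine summable_of_sum_range_le (c := (ENNReal.ofReal D * moment ν (d + s)).toReal)
    (fun n => by positivity) fun n => ?_
  have h4 := ENNReal.toReal_mono (ENNReal.mul_ne_top ENNReal.ofReal_ne_top hνs.ne) (key n)
  rw [ENNReal.toReal_sum fun k _ => ENNReal.mul_ne_top ENNReal.ofReal_ne_top (hfin k)] at h4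
  refine le_trans (Finset.sum_le_sum fun k _ => ?_) h4
  rw [ENNReal.toReal_mul, ENNReal.toReal_ofReal (by positivity)]

/-! ### Tail and moments of the cluster radius. -/

theorem exists_finset_cover (d : ℕ) : ∃ t : Finset (EuclideanSpace ℝ (Fin d)),
    Metric.closedBall 0 30 ⊆ ⋃ k ∈ t, Metric.ball k 1 := by
  obtain ⟨t, -, ht, hc⟩ := (isCompact_closedBall (0 : EuclideanSpace ℝ (Fin d)) 30).finite_cover_balls
    (e := 1) one_pos
  exact ⟨ht.toFinset, by simpa using hc⟩

variable {Ω : Type*} [MeasurableSpace Ω] {P : Measure Ω} [IsProbabilityMeasure P]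
  {ξ : Ω → Set (Marked d)} {lam : ℝ≥0} {ν : Measure (Set.Ioi (0 : ℝ))}

theorem IsPoissonPointProcess.measureReal_large_le [IsProbabilityMeasure ν]
    (h : IsPoissonPointProcess ξ (intensity d lam ν) P) (hν : moment ν d < ∞)
    (x : EuclideanSpace ℝ (Fin d)) (α : ℝ) :
    P.real {ω | (ξ ω ∩ large x α).Nonempty} ≤
      lam * (60 ^ d * volume.real (Metric.ball (0 : EuclideanSpace ℝ (Fin d)) 1)) *
        (tailMoment d ν α).toReal := by
  have h1 := h.measure_hit_le (measurableSet_large x α)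
  rw [intensity_large] at h1
  have h2 := ENNReal.toReal_mono (ENNReal.mul_ne_top (ENNReal.mul_ne_top ENNReal.coe_ne_top
    (ENNReal.mul_ne_top (by finiteness) measure_ball_lt_top.ne))
    ((tailMoment_le ν α).trans_lt hν).ne) h1
  simpa [measureReal_def] using h2

/-- A crossing needs a point in its window. This crude bound starts the induction at a small scale.
-/
theorem IsPoissonPointProcess.measureReal_crossing_le_volume [IsProbabilityMeasure ν]
    (h : IsPoissonPointProcess ξ (intensity d lam ν) P) (x : EuclideanSpace ℝ (Fin d)) {α : ℝ}
    (hα : 0 < α) :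
    P.real {ω | Crossing (ξ ω) x α} ≤
      lam * ((3 * α) ^ d * volume.real (Metric.ball (0 : EuclideanSpace ℝ (Fin d)) 1)) := by
  have hsub : {ω | Crossing (ξ ω) x α} ⊆ {ω | (ξ ω ∩ window x α).Nonempty} := by
    rintro ω ⟨p, hp, -⟩
    exact ⟨p, hp.2⟩
  have h1 := (measure_mono hsub).trans ((h.measure_hit_le (measurableSet_window x α)).trans
    (intensity_window_le lam ν x hα))
  have h2 := ENNReal.toReal_mono (ENNReal.mul_ne_top ENNReal.coe_ne_top
    (ENNReal.mul_ne_top ENNReal.ofReal_ne_top measure_ball_lt_top.ne)) h1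
  rwa [ENNReal.toReal_mul, ENNReal.toReal_mul, ENNReal.toReal_ofReal (by positivity)] at h2

/-- In the subcritical regime the tail of the cluster radius along a geometric sequence is
controlled by a contracting quadratic recursion driven by the tails of `r ^ d ν(dr)`. -/
theorem IsPoissonPointProcess.exists_sqIter_bound [IsProbabilityMeasure ν]
    (hd : 1 ≤ d)
    (h : IsPoissonPointProcess ξ (intensity d lam ν) P) (hν : moment ν d < ∞)
    {t : Finset (EuclideanSpace ℝ (Fin d))}
    (ht : Metric.closedBall 0 30 ⊆ ⋃ k ∈ t, Metric.ball k 1)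
    (hlam : (t.card : ℝ) ^ 2 * (lam * (60 ^ d *
      volume.real (Metric.ball (0 : EuclideanSpace ℝ (Fin d)) 1))) * (moment ν d).toReal ≤ 1 / 4) :
    ∃ α c : ℝ, 0 < α ∧ 0 ≤ c ∧ (∀ n : ℕ, c * (tailMoment d ν (10 ^ n * α)).toReal ≤ 1 / 4) ∧
      ∀ n : ℕ, P.real {ω | ENNReal.ofReal (4 * (10 ^ n * α)) < clusterRadius (ξ ω)} ≤
        sqIter (fun n => c * (tailMoment d ν (10 ^ n * α)).toReal) n +
          c * (tailMoment d ν (10 ^ n * α)).toReal := by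
  set V := volume.real (Metric.ball (0 : EuclideanSpace ℝ (Fin d)) 1) with hV
  set K : ℝ := (t.card : ℝ) ^ 2 with hK
  have hV0 : 0 ≤ V := measureReal_nonneg
  have hK1 : 1 ≤ K := by
    have h0 := ht (Metric.mem_closedBall_self (by norm_num))
    simp only [Set.mem_iUnion] at h0
    obtain ⟨k, hk, -⟩ := h0
    exact one_le_pow₀ (by exact_mod_cast Finset.card_pos.2 ⟨k, hk⟩)
  -- The initial scale may depend on `lam`. With `β = 3 * α ≤ 1` and `1 ≤ d`, `β ^ d ≤ β` makes a
  -- linear choice enough.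
  obtain ⟨α, hα, hbase⟩ : ∃ α : ℝ, 0 < α ∧ K * (lam * ((3 * α) ^ d * V)) ≤ 1 / 2 := by
    set A := K * (lam * V) with hA
    have hA0 : 0 ≤ A := by positivity
    set β : ℝ := min 1 (1 / (2 * (A + 1))) with hβ
    have hβ0 : 0 < β := lt_min one_pos (by positivity)
    refine ⟨β / 3, by positivity, ?_⟩
    have h1 : β ^ d ≤ β := pow_le_of_le_one hβ0.le (min_le_left _ _) (by omega)
    have h2 : β * (2 * (A + 1)) ≤ 1 := by
      rw [← le_div_iff₀ (by positivity)]
      exact min_le_right _ _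
    have h3 : A * β ^ d ≤ A * β := mul_le_mul_of_nonneg_left h1 hA0
    rw [mul_div_cancel₀ _ (by norm_num : (3 : ℝ) ≠ 0)]
    calc K * (lam * (β ^ d * V)) = A * β ^ d := by rw [hA]; ring
      _ ≤ 1 / 2 := by nlinarith
  set c := K * (lam * (60 ^ d * V)) with hc
  have hc0 : 0 ≤ c := by positivity
  set g : ℕ → ℝ := fun n => c * (tailMoment d ν (10 ^ n * α)).toReal with hg
  have hg0 : ∀ n, 0 ≤ g n := fun n => by positivity
  have hlarge : ∀ n x, K * P.real {ω | (ξ ω ∩ large x (10 ^ n * α)).Nonempty} ≤ g n := by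
    intro n x
    rw [hg, hc]
    simp only [mul_assoc K]
    gcongr
    exact h.measureReal_large_le hν x _
  -- Multiplying by `K`, the number of pairs of net points, normalises the quadratic coefficient to
  -- `1`.
  have hcross : ∀ n x, K * P.real {ω | Crossing (ξ ω) x (10 ^ n * α)} ≤ sqIter g n := by
    intro n
    induction n with
    | zero =>
      intro x
      rw [pow_zero, one_mul]
      refine le_trans ?_ hbase
      gcongr
      exact h.measureReal_crossing_le_volume x hα
    | succ n ih =>
      intro x
      have h1 := h.measureReal_crossing_le (α := 10 ^ n * α) (by positivity) ht
        (a := sqIter g n / K) (fun y => by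
          rw [le_div_iff₀ (by positivity), mul_comm]
          exact ih y) x
      rw [← hK] at h1
      rw [pow_succ', mul_assoc, sqIter]
      calc _ ≤ K * (P.real {ω | (ξ ω ∩ large x (10 ^ n * α)).Nonempty} +
            K * (sqIter g n / K) ^ 2) := by gcongr
        _ = sqIter g n ^ 2 + K * P.real {ω | (ξ ω ∩ large x (10 ^ n * α)).Nonempty} := by
            field_simp
            ring
        _ ≤ _ := by
            gcongr
            exact hlarge n x
  refine ⟨α, c, hα, hc0, fun n => le_trans ?_ hlam, fun n => ?_⟩
  · gcongr
    · exact hν.ne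
    · exact tailMoment_le ν _
  · have hsub : {ω | ENNReal.ofReal (4 * (10 ^ n * α)) < clusterRadius (ξ ω)} ⊆
        {ω | Crossing (ξ ω) 0 (10 ^ n * α)} ∪ {ω | (ξ ω ∩ large 0 (10 ^ n * α)).Nonempty} :=
      fun ω hω => crossing_or_large_of_lt_clusterRadius (by positivity) hω
    calc _ ≤ P.real {ω | Crossing (ξ ω) 0 (10 ^ n * α)} +
          P.real {ω | (ξ ω ∩ large 0 (10 ^ n * α)).Nonempty} :=
          (measureReal_mono hsub).trans (measureReal_union_le _ _)
      _ ≤ K * P.real {ω | Crossing (ξ ω) 0 (10 ^ n * α)} +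
          K * P.real {ω | (ξ ω ∩ large 0 (10 ^ n * α)).Nonempty} := by
          gcongr <;> exact le_mul_of_one_le_left measureReal_nonneg hK1
      _ ≤ _ := add_le_add (hcross n 0) (hlarge n 0)

theorem measure_clusterRadius_eq_top (hν : moment ν d < ∞) {α c : ℝ} (hα : 0 < α) (hc : 0 ≤ c)
    (hc1 : ∀ n : ℕ, c * (tailMoment d ν (10 ^ n * α)).toReal ≤ 1 / 4)
    (hP : ∀ n : ℕ, P.real {ω | ENNReal.ofReal (4 * (10 ^ n * α)) < clusterRadius (ξ ω)} ≤
        sqIter (fun n => c * (tailMoment d ν (10 ^ n * α)).toReal) n +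
          c * (tailMoment d ν (10 ^ n * α)).toReal) :
    P {ω | clusterRadius (ξ ω) = ⊤} = 0 := by
  rw [← measureReal_eq_zero_iff]
  refine le_antisymm ?_ measureReal_nonneg
  have hlim : Filter.Tendsto (fun n : ℕ => c * (tailMoment d ν (10 ^ n * α)).toReal)
      Filter.atTop (nhds 0) := by
    have := ((ENNReal.tendsto_toReal ENNReal.zero_ne_top).comp
      (tendsto_tailMoment hν hα)).const_mul c
    simpa using this
  have hlim' := (tendsto_sqIter (fun n => by positivity) hc1 hlim).add hlim
  rw [add_zero] at hlim'
  refine ge_of_tendsto' hlim' fun n => le_trans (measureReal_mono fun ω hω => ?_) (hP n)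
  rw [Set.mem_ofPred_eq] at hω ⊢
  rw [hω]
  exact ENNReal.ofReal_lt_top

/-- Split according to the first scale `4 * 10 ^ n * α` that bounds the radius. For `n + 1` the
scale `n` was exceeded, an event whose probability times `10 ^ (s * n)` is summable. -/
theorem lintegral_clusterRadius_rpow_lt_top
    (hM : Measurable fun ω => clusterRadius (ξ ω)) {s : ℝ} (hs : 0 < s)
    (hν : moment ν d < ∞) (hνs : moment ν (d + s) < ∞) {α c : ℝ} (hα : 0 < α) (hc : 0 ≤ c)
    (hc1 : ∀ n : ℕ, c * (tailMoment d ν (10 ^ n * α)).toReal ≤ 1 / 4)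
    (hP : ∀ n : ℕ, P.real {ω | ENNReal.ofReal (4 * (10 ^ n * α)) < clusterRadius (ξ ω)} ≤
        sqIter (fun n => c * (tailMoment d ν (10 ^ n * α)).toReal) n +
          c * (tailMoment d ν (10 ^ n * α)).toReal) :
    ∫⁻ ω, clusterRadius (ξ ω) ^ s ∂P < ∞ := by
  set g : ℕ → ℝ := fun n => c * (tailMoment d ν (10 ^ n * α)).toReal with hg
  have hg0 : ∀ n, 0 ≤ g n := fun n => by positivity
  set q : ℝ := (10 : ℝ) ^ s with hq
  have hq1 : 1 ≤ q := Real.one_le_rpow (by norm_num) hs.le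
  have hsg : Summable fun n => q ^ n * g n := by
    refine ((summable_pow_mul_tailMoment hs hν hνs hα).mul_left c).congr fun n => ?_
    rw [hg]
    ring
  have hsum : Summable fun n => (40 * α) ^ s * (q ^ n * (sqIter g n + g n)) := by
    refine Summable.mul_left _ ?_
    simp only [mul_add]
    exact (summable_pow_mul_sqIter hq1 hg0 hc1 hsg).add hsg
  have hscale : ∀ n : ℕ, (4 * (10 ^ (n + 1) * α)) ^ s = (40 * α) ^ s * q ^ n := by
    intro n
    rw [hq, Real.rpow_pow_comm (by norm_num), ← Real.mul_rpow (by positivity) (by positivity),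
      pow_succ]
    congr 1
    ring
  set E : ℕ → Set Ω := fun n => {ω | ENNReal.ofReal (4 * (10 ^ n * α)) < clusterRadius (ξ ω)}
  have hE : ∀ n, MeasurableSet (E n) := fun n => measurableSet_lt measurable_const hM
  have hpt : ∀ᵐ ω ∂P, clusterRadius (ξ ω) ^ s ≤ ENNReal.ofReal (4 * α) ^ s +
      ∑' n, (E n).indicator (fun _ => ENNReal.ofReal ((4 * (10 ^ (n + 1) * α)) ^ s)) ω := by
    have htop : ∀ᵐ ω ∂P, clusterRadius (ξ ω) ≠ ⊤ :=
      ae_iff.2 (by simpa using measure_clusterRadius_eq_top hν hα hc hc1 hP)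
    filter_upwards [htop] with ω hω
    have hex : ∃ n : ℕ, clusterRadius (ξ ω) ≤ ENNReal.ofReal (4 * (10 ^ n * α)) := by
      obtain ⟨n, hn⟩ := pow_unbounded_of_one_lt ((clusterRadius (ξ ω)).toReal / α)
        (by norm_num : (1 : ℝ) < 10)
      refine ⟨n, ENNReal.le_ofReal_iff_toReal_le hω (by positivity) |>.2 ?_⟩
      rw [div_lt_iff₀ hα] at hn
      have : 0 < 10 ^ n * α := by positivity
      linarith
    classical
    have hle := Nat.find_spec hex
    rcases hn : Nat.find hex with _ | n
    · rw [hn, pow_zero, one_mul] at hle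
      exact le_add_right (ENNReal.rpow_le_rpow hle hs.le)
    · have hlt := Nat.find_min hex (m := n) (by omega)
      rw [hn] at hle
      rw [not_le] at hlt
      refine le_add_left (le_trans ?_ (ENNReal.le_tsum n))
      rw [Set.indicator_of_mem (by exact hlt), ← ENNReal.ofReal_rpow_of_pos (by positivity)]
      exact ENNReal.rpow_le_rpow hle hs.le
  refine (lintegral_mono_ae hpt).trans_lt ?_
  rw [lintegral_add_left measurable_const, lintegral_const, measure_univ, mul_one,
    lintegral_tsum fun n => (measurable_const.indicator (hE n)).aemeasurable]
  refine ENNReal.add_lt_top.2 ⟨ENNReal.rpow_lt_top_of_nonneg hs.le ENNReal.ofReal_ne_top, ?_⟩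
  refine lt_of_le_of_lt (ENNReal.tsum_le_tsum fun n => ?_) hsum.tsum_ofReal_lt_top
  rw [lintegral_indicator_const (hE n), hscale, ← mul_assoc,
    ENNReal.ofReal_mul (p := (40 * α) ^ s * q ^ n) (by positivity), ← ofReal_measureReal]
  exact mul_le_mul_right (ENNReal.ofReal_le_ofReal (hP n)) _

theorem moment_lt_top_of_le [IsProbabilityMeasure ν] {p q : ℝ} (hp : 0 ≤ p) (hpq : p ≤ q) (h : moment ν q < ∞) :
    moment ν p < ∞ := by
  have hle : moment ν p ≤ ∫⁻ r, (1 + ENNReal.ofReal ((r : ℝ) ^ q)) ∂ν := by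
    refine lintegral_mono fun r => ?_
    have hr : (0 : ℝ) < r := r.2
    rcases le_total (r : ℝ) 1 with h1 | h1
    · exact le_add_right (ENNReal.ofReal_le_one.2 (Real.rpow_le_one hr.le h1 hp))
    · exact le_add_left (ENNReal.ofReal_le_ofReal (Real.rpow_le_rpow_of_exponent_le h1 hpq))
  refine hle.trans_lt ?_
  rw [lintegral_add_left measurable_const, lintegral_const, measure_univ, mul_one]
  exact ENNReal.add_lt_top.2 ⟨ENNReal.one_lt_top, h⟩

/-- A positive density threshold, depending on the dimension only, for the multiscale argument. -/
theorem exists_density_threshold (d : ℕ) : ∃ C : ℝ≥0, 0 < C ∧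
    ∃ t : Finset (EuclideanSpace ℝ (Fin d)), Metric.closedBall 0 30 ⊆ ⋃ k ∈ t, Metric.ball k 1 ∧
      ∀ (ν : Measure (Set.Ioi (0 : ℝ))) (lam : ℝ≥0), (lam : ℝ≥0∞) < C * (moment ν d)⁻¹ →
        (t.card : ℝ) ^ 2 * (lam * (60 ^ d *
          volume.real (Metric.ball (0 : EuclideanSpace ℝ (Fin d)) 1))) * (moment ν d).toReal ≤
            1 / 4 := by
  obtain ⟨t, ht⟩ := exists_finset_cover d
  set V := volume.real (Metric.ball (0 : EuclideanSpace ℝ (Fin d)) 1)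
  have hV0 : 0 ≤ V := measureReal_nonneg
  set w : ℝ := (t.card : ℝ) ^ 2 * (60 ^ d * V) with hw
  have hw0 : 0 ≤ w := by positivity
  -- Any positive constant with `w * C ≤ 1 / 4` would do; the `+ 1` avoids having to prove `w ≠ 0`.
  refine ⟨(1 / (4 * (w + 1))).toNNReal, Real.toNNReal_pos.2 (by positivity), t, ht,
    fun ν lam hlam => ?_⟩
  have h1 := mul_le_mul_left hlam.le (moment ν d)
  rw [mul_assoc] at h1
  have h2 := ENNReal.toReal_mono (by finiteness)
    (h1.trans (mul_le_of_le_one_right' (ENNReal.inv_mul_le_one _)))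
  rw [ENNReal.toReal_mul, ENNReal.coe_toReal, ENNReal.coe_toReal,
    Real.coe_toNNReal _ (by positivity), le_div_iff₀ (by positivity)] at h2
  have h3 : 0 ≤ (lam : ℝ) * (moment ν d).toReal := by positivity
  calc _ = w * (lam * (moment ν d).toReal) := by rw [hw]; ring
    _ ≤ 1 / 4 := by nlinarith

end BooleanModel

theorem lemma3p8 (d : ℕ) (hd : 1 ≤ d) :
    ∃ C : ℝ≥0, 0 < C ∧
      ∀ (ν : Measure (Set.Ioi (0 : ℝ))) [IsProbabilityMeasure ν],
        (BooleanModel.moment ν d < ∞ →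
          ∀ lam : ℝ≥0, 0 < lam → (lam : ℝ≥0∞) < C * (BooleanModel.moment ν d)⁻¹ →
            ∀ (Ω : Type u) [MeasurableSpace Ω] (P : Measure Ω) [IsProbabilityMeasure P]
              (ξ : Ω → Set (BooleanModel.Marked d)),
              BooleanModel.IsPoissonPointProcess ξ (BooleanModel.intensity d lam ν) P →
                P {ω | BooleanModel.Percolates (ξ ω)} = 0) ∧
        (∀ s : ℝ, 0 < s → BooleanModel.moment ν (d + s) < ∞ →
          ∀ lam : ℝ≥0, 0 < lam → (lam : ℝ≥0∞) < C * (BooleanModel.moment ν d)⁻¹ →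
            ∀ (Ω : Type u) [MeasurableSpace Ω] (P : Measure Ω) [IsProbabilityMeasure P]
              (ξ : Ω → Set (BooleanModel.Marked d)),
              BooleanModel.IsPoissonPointProcess ξ (BooleanModel.intensity d lam ν) P →
                Measurable (fun ω => BooleanModel.clusterRadius (ξ ω)) ∧
                  ∫⁻ ω, BooleanModel.clusterRadius (ξ ω) ^ s ∂P < ∞) := by
  obtain ⟨C, hC, t, ht, hthr⟩ := BooleanModel.exists_density_threshold d
  refine ⟨C, hC, fun ν _ => ⟨?_, ?_⟩⟩
  · intro hν lam _ hlam Ω _ P _ ξ h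
    obtain ⟨α, c, hα, hc, hc1, hP⟩ := h.exists_sqIter_bound hd hν ht (hthr ν lam hlam)
    exact measure_mono_null (fun ω hω => BooleanModel.clusterRadius_eq_top_of_percolates hω)
      (BooleanModel.measure_clusterRadius_eq_top hν hα hc hc1 hP)
  · intro s hs hνs lam _ hlam Ω _ P _ ξ h
    have hν : BooleanModel.moment ν d < ∞ :=
      BooleanModel.moment_lt_top_of_le (Nat.cast_nonneg d) (by linarith) hνs
    obtain ⟨α, c, hα, hc, hc1, hP⟩ := h.exists_sqIter_bound hd hν ht (hthr ν lam hlam)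
    exact ⟨h.measurable_clusterRadius, BooleanModel.lintegral_clusterRadius_rpow_lt_top
      h.measurable_clusterRadius hs hν hνs hα hc hc1 hP⟩
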